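/- Let $K$ be a number field with ring of integers $O_K$, let $\bar K$ be a separable closure of $K$, and for an extension $L/K$ inside $\bar K$ (including $L=\bar K$) let $O_L$ be the ring of algebraic integers in $L$. Let $P_K$ be the set of nonzero prime ideals of $O_K$, $I_K$ the monoid of nonzero ideals of $O_K$, and $k_{\mathfrak p}=O_K/\mathfrak p$ for $\mathfrak p\in P_K$. For a flat $O_K$-algebra $A$ and $\mathfrak p\in P_K$, let $\psi_{\mathfrak p}:A^{I_K}\to A^{I_K}$ be the shift $\psi_{\mathfrak p}\big((\xi_{\mathfrak a})_{\mathfrak a}\big)=(\xi_{\mathfrak p\mathfrak a})_{\mathfrak a}$. Put $U_0(A)=A^{I_K}$ and $$U_{n+1}(A)=\{\xi\in U_n(A)\mid \psi_{\mathfrak p}\xi-\xi^{\#k_{\mathfrak p}}\in\mathfrak p\,U_n(A)\ \text{for all } \mathfrak p\in P_K\}.$$ The ring of Witt vectors over $O_K$ with coefficients in $A$ is $W_{O_K}(A)=\bigcap_{n\ge 0}U_n(A)$, an $O_K$-subalgebra of $A^{I_K}$. A subalgebra $B\subseteq A^{I_K}$ is called a sub-$\Lambda_{O_K}$-ring if it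 is flat over $O_K$, stable under every $\psi_{\mathfrak p}$, and satisfies $\psi_{\mathfrak p}\xi-\xi^{\#k_{\mathfrak p}}\in\mathfrak pB$ for all $\xi\in B$ and $\mathfrak p\in P_K$. A Witt vector $\xi=(\xi_{\mathfrak a})\in W_{O_K}(A)$ is called automatic if there are a finite set $S$, a map $\delta:S\times P_K\to S$, an element $s_0\in S$ and a map $\tau:S\to A$ such that for every finite word $u=\mathfrak p_1\cdots\mathfrak p_r$ over $P_K$ (including the empty word) one has $\xi_{\mathfrak p_1\mathfrak p_2\cdots\mathfrak p_r}=\tau(\delta^*(s_0,u))$, where $\delta^*(s_0,u)$ is the state reached from $s_0$ by reading the letters of $u$ successively. Let $W^a_{O_K}(A)\subseteq W_{O_K}(A)$ be the $O_K$-subalgebra of automatic Witt vectors. Then a Witt vector $\xi\in W_{O_K}(O_{\bar K})$ is integral over $O_K$ if and only if it is automatic. Moreover, $W^a_{O_K}(O_{\bar K})$ and all $W^a_{O_K}(O_L)$, for $L/K$ finite inside $\bar K$, are sub-$\Lambda_{O_K}$-rings of $O_{\bar K}^{I_K}$ and $O_L^{I_K}$ respectively, and, regarding $O_L^{I_K}$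 as a subset of $O_{\bar K}^{I_K}$ componentwise, $$W^a_{O_K}(O_{\bar K})=\bigcup_{L/K}W^a_{O_K}(O_L),$$ where $L$ runs over the finite extensions of $K$ contained in $\bar K$. -/

import Mathlib

open scoped nonZeroDivisors NumberField

/-! ## Automata with output -/

/-- A deterministic automaton with output, with input alphabet `Δ`, output alphabet `O` and
state set `S`. Finiteness of `S` is required where automata are used. -/
structure DFAO (Δ O S : Type*) where
  /-- transition function -/
  step : S → Δ → S
  /-- initial state -/
  start : S
  /-- output function -/
  out : S → O

namespace DFAO

variable {Δ O S : Type*}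

/-- The state reached from the initial state after reading the word `u` from left to right. -/
def run (M : DFAO Δ O S) (u : List Δ) : S := u.foldl M.step M.start

/-- The output of the automaton on the word `u`. -/
def eval (M : DFAO Δ O S) (u : List Δ) : O := M.out (M.run u)

/-- Two automata run in parallel, their outputs being combined by `f`. -/
def pair {O₁ O₂ S₁ S₂ : Type*} (f : O₁ → O₂ → O) (M : DFAO Δ O₁ S₁) (N : DFAO Δ O₂ S₂) :
    DFAO Δ O (S₁ × S₂) where
  step s a := (M.step s.1 a, N.step s.2 a)
  start := (M.start, N.start)
  out s := f (M.out s.1) (N.out s.2)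

theorem eval_pair {O₁ O₂ S₁ S₂ : Type*} (f : O₁ → O₂ → O) (M : DFAO Δ O₁ S₁)
    (N : DFAO Δ O₂ S₂) (u : List Δ) : (pair f M N).eval u = f (M.eval u) (N.eval u) := by
  have key : ∀ (u : List Δ) (s : S₁) (t : S₂),
      u.foldl (pair f M N).step (s, t) = (u.foldl M.step s, u.foldl N.step t) := by
    intro u
    induction u with
    | nil => intro s t; rfl
    | cons a u ih => intro s t; exact ih _ _
  unfold eval run
  have h := key u M.start N.start
  change (pair f M N).out (u.foldl (pair f M N).step (M.start, N.start)) = _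
  rw [h]
  rfl

end DFAO

/-! ## Witt vectors over a Dedekind domain, with coefficients in a flat algebra -/

namespace ArithWitt

open IsDedekindDomain

section Defs

variable (R : Type*) [CommRing R] [IsDedekindDomain R]

/-- The monoid of nonzero ideals of `R`. -/
abbrev Idl : Type _ := (Ideal R)⁰

variable {R}

/-- A nonzero prime ideal as an element of the monoid of nonzero ideals. -/
def primeIdl (p : HeightOneSpectrum R) : Idl R :=
  ⟨p.asIdeal, mem_nonZeroDivisors_of_ne_zero p.ne_bot⟩

/-- The cardinality of the residue field at `p`. -/
noncomputable def resCard (p : HeightOneSpectrum R) : ℕ := Nat.card (R ⧸ p.asIdeal)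

variable (A : Type*) [CommRing A] [Algebra R A]

/-- The shift `(ψ_p ξ)_a = ξ_{p a}` on the product `A ^ (nonzero ideals)`. -/
def shift (p : HeightOneSpectrum R) : (Idl R → A) →ₐ[R] (Idl R → A) where
  toFun ξ a := ξ (primeIdl p * a)
  map_one' := rfl
  map_mul' _ _ := rfl
  map_zero' := rfl
  map_add' _ _ := rfl
  commutes' _ := rfl

variable {A}

theorem shift_comm (p q : HeightOneSpectrum R) (ξ : Idl R → A) :
    shift A p (shift A q ξ) = shift A q (shift A p ξ) := by
  funext a
  change ξ (primeIdl q * (primeIdl p * a)) = ξ (primeIdl p * (primeIdl q * a))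
  rw [mul_left_comm]

/-- The `R`-submodule `p B` of the product, for a prime `p` of `R` and a subalgebra `B`:
finite sums of products `r * b` with `r ∈ p` and `b ∈ B`. -/
def primeMul (p : HeightOneSpectrum R) (B : Subalgebra R (Idl R → A)) :
    Submodule R (Idl R → A) :=
  p.asIdeal • Subalgebra.toSubmodule B

theorem primeMul_le (p : HeightOneSpectrum R) (B : Subalgebra R (Idl R → A))
    {x : Idl R → A} (hx : x ∈ primeMul p B) : x ∈ B :=
  (Submodule.smul_le_right : p.asIdeal • Subalgebra.toSubmodule B ≤ _) hx

theorem smul_mem_primeMul (p : HeightOneSpectrum R) (B : Subalgebra R (Idl R → A))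
    {r : R} (hr : r ∈ p.asIdeal) {x : Idl R → A} (hx : x ∈ B) : r • x ∈ primeMul p B :=
  Submodule.smul_mem_smul hr hx

theorem mul_mem_primeMul (p : HeightOneSpectrum R) (B : Subalgebra R (Idl R → A))
    {x y : Idl R → A} (hx : x ∈ primeMul p B) (hy : y ∈ B) : x * y ∈ primeMul p B := by
  unfold primeMul at hx
  induction hx using Submodule.smul_induction_on' with
  | smul r hr n hn =>
    rw [smul_mul_assoc]
    exact smul_mem_primeMul p B hr (B.mul_mem hn hy)
  | add a _ b _ ha hb =>
    rw [add_mul]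
    exact Submodule.add_mem _ ha hb

variable [Ring.HasFiniteQuotients R]

theorem sub_pow_resCard_mem (p : HeightOneSpectrum R) (r : R) :
    r - r ^ resCard p ∈ p.asIdeal := by
  have : Finite (R ⧸ p.asIdeal) := Ring.HasFiniteQuotients.finiteQuotient p.ne_bot
  have : p.asIdeal.IsMaximal := p.isMaximal
  let _ := Ideal.Quotient.field p.asIdeal
  let _ := Fintype.ofFinite (R ⧸ p.asIdeal)
  rw [← Ideal.Quotient.eq_zero_iff_mem, map_sub, map_pow, resCard, Nat.card_eq_fintype_card,
    FiniteField.pow_card, sub_self]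

theorem add_pow_resCard_mem (p : HeightOneSpectrum R) (B : Subalgebra R (Idl R → A))
    {x y : Idl R → A} (hx : x ∈ B) (hy : y ∈ B) :
    (x + y) ^ resCard p - (x ^ resCard p + y ^ resCard p) ∈ primeMul p B := by
  have : Finite (R ⧸ p.asIdeal) := Ring.HasFiniteQuotients.finiteQuotient p.ne_bot
  have : p.asIdeal.IsMaximal := p.isMaximal
  let _ := Ideal.Quotient.field p.asIdeal
  let _ := Fintype.ofFinite (R ⧸ p.asIdeal)
  obtain ⟨ℓ, hℓ⟩ := CharP.exists (R ⧸ p.asIdeal)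
  obtain ⟨n, hprime, hn⟩ := FiniteField.card (R ⧸ p.asIdeal) ℓ
  have hmem : (ℓ : R) ∈ p.asIdeal := by
    rw [← Ideal.Quotient.eq_zero_iff_mem, map_natCast]
    exact CharP.cast_eq_zero _ _
  have hq : resCard p = ℓ ^ (n : ℕ) := by rw [resCard, Nat.card_eq_fintype_card, hn]
  obtain ⟨r, hr⟩ := exists_add_pow_prime_pow_eq hprime (⟨x, hx⟩ : B) ⟨y, hy⟩ n
  have hr' := congrArg (Subtype.val) hr
  simp only [Subalgebra.coe_add, Subalgebra.coe_mul, Subalgebra.coe_pow] at hr'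
  rw [hq, hr', add_sub_cancel_left]
  have h2 := smul_mem_primeMul p B hmem (B.mul_mem (B.mul_mem hx hy) r.2)
  convert h2 using 1
  rw [Algebra.smul_def, map_natCast]
  simp [mul_assoc]

/-- One step of the construction of Witt vectors:
`{ξ ∈ B | ψ_p ξ - ξ ^ #k_p ∈ p B for all nonzero primes p}`. -/
def nextU (B : Subalgebra R (Idl R → A)) : Subalgebra R (Idl R → A) where
  carrier := {ξ | ξ ∈ B ∧ ∀ p : HeightOneSpectrum R,
    shift A p ξ - ξ ^ resCard p ∈ primeMul p B}
  mul_mem' := by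
    rintro x y ⟨hx, hx'⟩ ⟨hy, hy'⟩
    refine ⟨B.mul_mem hx hy, fun p => ?_⟩
    have hsx : shift A p x ∈ B := by
      have := B.add_mem (primeMul_le p B (hx' p)) (B.pow_mem hx (resCard p))
      rwa [sub_add_cancel] at this
    have e : shift A p (x * y) - (x * y) ^ resCard p
        = (shift A p y - y ^ resCard p) * shift A p x
          + (shift A p x - x ^ resCard p) * y ^ resCard p := by
      rw [map_mul, mul_pow]; ring
    rw [e]
    exact Submodule.add_mem _ (mul_mem_primeMul p B (hy' p) hsx)
      (mul_mem_primeMul p B (hx' p) (B.pow_mem hy _))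
  add_mem' := by
    rintro x y ⟨hx, hx'⟩ ⟨hy, hy'⟩
    refine ⟨B.add_mem hx hy, fun p => ?_⟩
    have e : shift A p (x + y) - (x + y) ^ resCard p
        = (shift A p x - x ^ resCard p) + (shift A p y - y ^ resCard p)
          - ((x + y) ^ resCard p - (x ^ resCard p + y ^ resCard p)) := by
      rw [map_add]; ring
    rw [e]
    exact Submodule.sub_mem _ (Submodule.add_mem _ (hx' p) (hy' p))
      (add_pow_resCard_mem p B hx hy)
  algebraMap_mem' := by
    intro r
    refine ⟨B.algebraMap_mem r, fun p => ?_⟩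
    rw [AlgHom.commutes, ← map_pow, ← map_sub, Algebra.algebraMap_eq_smul_one]
    exact smul_mem_primeMul p B (sub_pow_resCard_mem p r) B.one_mem

variable (R A)

/-- The subalgebras `U_n(A)`: `U_0(A)` is the whole product and
`U_{n+1}(A) = {ξ ∈ U_n(A) | ψ_p ξ - ξ ^ #k_p ∈ p U_n(A) for all p}`. -/
def U : ℕ → Subalgebra R (Idl R → A)
  | 0 => ⊤
  | n + 1 => nextU (U n)

/-- The ring `W_R(A) = ⋂ n, U_n(A)` of Witt vectors with coefficients in the flat
`R`-algebra `A`. -/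
def W : Subalgebra R (Idl R → A) := ⨅ n : ℕ, U R A n

variable {R A}

/-- The family `ξ` is automatic: there is a finite automaton with output, over the alphabet of
nonzero primes of `R`, which on each word `p₁ p₂ ⋯ p_r` outputs the coefficient of `ξ`
at the ideal `p₁ p₂ ⋯ p_r`. -/
def IsAutomatic (ξ : Idl R → A) : Prop :=
  ∃ (S : Type) (_ : Finite S) (M : DFAO (HeightOneSpectrum R) A S),
    ∀ u : List (HeightOneSpectrum R), ξ (u.map primeIdl).prod = M.eval u

variable (R A)

/-- The ring `W^a_R(A)` of automatic Witt vectors. -/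
def Wa : Subalgebra R (Idl R → A) where
  carrier := {ξ | ξ ∈ W R A ∧ IsAutomatic ξ}
  mul_mem' := by
    rintro x y ⟨hx, S, hS, M, hM⟩ ⟨hy, T, hT, N, hN⟩
    refine ⟨mul_mem hx hy, S × T, inferInstance, DFAO.pair (· * ·) M N, fun u => ?_⟩
    rw [DFAO.eval_pair, ← hM, ← hN, Pi.mul_apply]
  add_mem' := by
    rintro x y ⟨hx, S, hS, M, hM⟩ ⟨hy, T, hT, N, hN⟩
    refine ⟨add_mem hx hy, S × T, inferInstance, DFAO.pair (· + ·) M N, fun u => ?_⟩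
    rw [DFAO.eval_pair, ← hM, ← hN, Pi.add_apply]
  algebraMap_mem' := by
    intro r
    exact ⟨(W R A).algebraMap_mem r, Unit, inferInstance,
      ⟨fun s _ => s, (), fun _ => algebraMap R A r⟩, fun u => rfl⟩

variable {R A}

/-- A subalgebra `B` of the product `A ^ (nonzero ideals)` is a `Λ_R`-ring under the shifts: it is
flat over `R`, stable under every `ψ_p`, and `ψ_p ξ - ξ ^ #k_p ∈ p B` for all `ξ ∈ B`.
(The shifts commute, by `shift_comm`.) -/
structure IsLambdaSubring (B : Subalgebra R (Idl R → A)) : Prop where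
  flat : Module.Flat R B
  shift_mem : ∀ (p : HeightOneSpectrum R), ∀ ξ ∈ B, shift A p ξ ∈ B
  frobenius : ∀ (p : HeightOneSpectrum R), ∀ ξ ∈ B, shift A p ξ - ξ ^ resCard p ∈ primeMul p B

/-- The componentwise map `A ^ (nonzero ideals) → B ^ (nonzero ideals)` induced by `f : A → B`. -/
def coeffMap {B : Type*} [CommRing B] [Algebra R B] (f : A →ₐ[R] B) :
    (Idl R → A) →ₐ[R] (Idl R → B) where
  toFun ξ a := f (ξ a)
  map_one' := by funext a; simp
  map_mul' _ _ := by funext a; simp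
  map_zero' := by funext a; simp
  map_add' _ _ := by funext a; simp
  commutes' r := by funext a; simp

end Defs

end ArithWitt

namespace ArithWitt

open IsDedekindDomain

section Descent

variable {R : Type*} [CommRing R] [IsDedekindDomain R]

theorem exists_mul_eq_span_singleton {I : Ideal R} (hI : I ≠ ⊥) :
    ∃ (c : R) (J : Ideal R), c ≠ 0 ∧ I * J = Ideal.span {c} := by
  obtain ⟨c, hc, hc0⟩ := Submodule.exists_mem_ne_zero_of_ne_bot hI
  obtain ⟨J, hJ⟩ := Ideal.dvd_iff_le.mpr ((Ideal.span_singleton_le_iff_mem I).mpr hc)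
  exact ⟨c, J, hc0, hJ.symm⟩

theorem mem_smul_iff_of_mul_eq_span_singleton {M : Type*} [AddCommGroup M] [Module R M]
    [Module.IsTorsionFree R M] {I J : Ideal R} {c : R} (hc : c ≠ 0)
    (h : I * J = Ideal.span {c}) (N : Submodule R M) (x : M) :
    x ∈ I • N ↔ ∀ j ∈ J, ∃ b ∈ N, c • b = j • x := by
  constructor
  · intro hx j hj
    induction hx using Submodule.smul_induction_on' with
    | smul r hr n hn =>
      have : r * j ∈ Ideal.span {c} := h ▸ Ideal.mul_mem_mul hr hj
      obtain ⟨t, ht⟩ := Ideal.mem_span_singleton'.mp this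
      exact ⟨t • n, N.smul_mem t hn, by rw [smul_smul, smul_smul, mul_comm c, ht, mul_comm]⟩
    | add x _ y _ hx hy =>
      obtain ⟨b, hb, e⟩ := hx
      obtain ⟨b', hb', e'⟩ := hy
      exact ⟨b + b', N.add_mem hb hb', by rw [smul_add, smul_add, e, e']⟩
  · intro hx
    have key : ∀ d ∈ I * J, ∃ b ∈ I • N, c • b = d • x := by
      intro d hd
      induction hd using Submodule.mul_induction_on' with
      | mem_mul_mem m hm j hj =>
        obtain ⟨b, hb, e⟩ := hx j hj
        exact ⟨m • b, Submodule.smul_mem_smul hm hb, by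
          rw [smul_comm, e, smul_smul]⟩
      | add d _ d' _ h1 h2 =>
        obtain ⟨b, hb, e⟩ := h1
        obtain ⟨b', hb', e'⟩ := h2
        exact ⟨b + b', Submodule.add_mem _ hb hb', by rw [smul_add, add_smul, e, e']⟩
    obtain ⟨b, hb, e⟩ := key c (h ▸ Ideal.mem_span_singleton_self c)
    rwa [← smul_right_injective M hc e]

end Descent

section Automatic

variable {R : Type*} [CommRing R] [IsDedekindDomain R]

theorem IsAutomatic.comp {A B : Type*} {ξ : Idl R → A} (h : IsAutomatic ξ) {η : Idl R → B}
    (f : A → B) (hf : ∀ a, η a = f (ξ a)) : IsAutomatic η := by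
  obtain ⟨S, hS, M, hM⟩ := h
  exact ⟨S, hS, ⟨M.step, M.start, f ∘ M.out⟩, fun u => by rw [hf, hM]; rfl⟩

theorem IsAutomatic.shift {A : Type*} [CommRing A] [Algebra R A] {ξ : Idl R → A}
    (h : IsAutomatic ξ) (p : HeightOneSpectrum R) : IsAutomatic (shift A p ξ) := by
  obtain ⟨S, hS, M, hM⟩ := h
  exact ⟨S, hS, ⟨M.step, M.step M.start p, M.out⟩, fun u => hM (p :: u)⟩

end Automatic

section Lambda

variable {R : Type*} [CommRing R] [IsDedekindDomain R] [Ring.HasFiniteQuotients R]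
variable {A : Type*} [CommRing A] [Algebra R A]

theorem mem_W {ξ : Idl R → A} : ξ ∈ W R A ↔ ∀ n, ξ ∈ U R A n := by
  simp [W, Algebra.mem_iInf]

theorem shift_mem_U {n : ℕ} {ξ : Idl R → A} (h : ξ ∈ U R A (n + 1))
    (p : HeightOneSpectrum R) : shift A p ξ ∈ U R A n := by
  have := (U R A n).add_mem (primeMul_le p _ (h.2 p)) ((U R A n).pow_mem h.1 (resCard p))
  rwa [sub_add_cancel] at this

theorem shift_mem_W {ξ : Idl R → A} (h : ξ ∈ W R A) (p : HeightOneSpectrum R) :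
    shift A p ξ ∈ W R A :=
  mem_W.mpr fun n => shift_mem_U (mem_W.mp h (n + 1)) p

variable [Module.IsTorsionFree R A]

theorem shift_sub_pow_mem_primeMul_W {ξ : Idl R → A} (h : ξ ∈ W R A)
    (p : HeightOneSpectrum R) : shift A p ξ - ξ ^ resCard p ∈ primeMul p (W R A) := by
  obtain ⟨c, J, hc, hJ⟩ := exists_mul_eq_span_singleton p.ne_bot
  refine (mem_smul_iff_of_mul_eq_span_singleton hc hJ _ _).mpr fun j hj => ?_
  have key : ∀ n, ∃ b ∈ U R A n, c • b = j • (shift A p ξ - ξ ^ resCard p) := fun n =>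
    (mem_smul_iff_of_mul_eq_span_singleton hc hJ _ _).mp ((mem_W.mp h (n + 1)).2 p) j hj
  obtain ⟨b, -, e⟩ := key 0
  refine ⟨b, mem_W.mpr fun n => ?_, e⟩
  obtain ⟨b', hb', e'⟩ := key n
  rwa [smul_right_injective _ hc (e.trans e'.symm)]

theorem isLambdaSubring_Wa : IsLambdaSubring (Wa R A) where
  flat := by
    have : Module.IsTorsionFree R (Wa R A) :=
      Subtype.val_injective.moduleIsTorsionFree _ fun _ _ => rfl
    infer_instance
  shift_mem p ξ h := ⟨shift_mem_W h.1 p, h.2.shift p⟩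
  frobenius p ξ h := by
    have hmem : shift A p ξ - ξ ^ resCard p ∈ Wa R A :=
      (Wa R A).sub_mem ⟨shift_mem_W h.1 p, h.2.shift p⟩ ((Wa R A).pow_mem h _)
    obtain ⟨c, J, hc, hJ⟩ := exists_mul_eq_span_singleton p.ne_bot
    refine (mem_smul_iff_of_mul_eq_span_singleton hc hJ _ _).mpr fun j hj => ?_
    obtain ⟨b, hb, e⟩ := (mem_smul_iff_of_mul_eq_span_singleton hc hJ _ _).mp
      (shift_sub_pow_mem_primeMul_W h.1 p) j hj
    have : Nonempty A := ⟨0⟩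
    have hinj : Function.Injective fun x : A => c • x := smul_right_injective A hc
    refine ⟨b, ⟨hb, ((Wa R A).smul_mem hmem j).2.comp (Function.invFun fun x : A => c • x)
      fun a => ?_⟩, e⟩
    rw [← e]
    exact (Function.leftInverse_invFun hinj (b a)).symm

end Lambda

section CoeffMap

variable {R : Type*} [CommRing R] [IsDedekindDomain R] [Ring.HasFiniteQuotients R]
variable {A B : Type*} [CommRing A] [Algebra R A] [CommRing B] [Algebra R B]

theorem coeffMap_mem_U (f : A →ₐ[R] B) (n : ℕ) {ξ : Idl R → A} (h : ξ ∈ U R A n) :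
    coeffMap f ξ ∈ U R B n := by
  induction n generalizing ξ with
  | zero => trivial
  | succ n ih =>
    refine ⟨ih h.1, fun p => ?_⟩
    have key : primeMul p (U R A n) ≤ (primeMul p (U R B n)).comap (coeffMap f).toLinearMap :=
      Submodule.smul_le.mpr fun r hr b hb => by
        rw [Submodule.mem_comap, map_smul]
        exact Submodule.smul_mem_smul hr (ih hb)
    have := key (h.2 p)
    rw [Submodule.mem_comap, AlgHom.toLinearMap_apply, map_sub, map_pow] at this
    exact this

theorem coeffMap_mem_W (f : A →ₐ[R] B) {ξ : Idl R → A} (h : ξ ∈ W R A) :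
    coeffMap f ξ ∈ W R B :=
  mem_W.mpr fun n => coeffMap_mem_U f n (mem_W.mp h n)

theorem mem_U_of_coeffMap_mem_U [Module.IsTorsionFree R A] [Module.IsTorsionFree R B]
    {f : A →ₐ[R] B} (hf : Function.Injective f)
    (hsat : ∀ (c : R) (b : B) (a : A), c ≠ 0 → c • b = f a → b ∈ f.range) (n : ℕ)
    {ξ : Idl R → A} (h : coeffMap f ξ ∈ U R B n) : ξ ∈ U R A n := by
  induction n generalizing ξ with
  | zero => trivial
  | succ n ih =>
    refine ⟨ih h.1, fun p => ?_⟩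
    obtain ⟨c, J, hc, hJ⟩ := exists_mul_eq_span_singleton p.ne_bot
    refine (mem_smul_iff_of_mul_eq_span_singleton hc hJ _ _).mpr fun j hj => ?_
    obtain ⟨b, hb, e⟩ := (mem_smul_iff_of_mul_eq_span_singleton hc hJ _ _).mp (h.2 p) j hj
    have e' : c • b = coeffMap f (j • (shift A p ξ - ξ ^ resCard p)) := by
      rw [e, map_smul, map_sub, map_pow]; rfl
    choose η hη using fun a => hsat c (b a) _ hc (congrFun e' a)
    have hb' : coeffMap f η = b := funext hη
    refine ⟨η, ih (hb' ▸ hb), ?_⟩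
    have hinj : Function.Injective (coeffMap f : (Idl R → A) → _) := hf.comp_left
    exact hinj (by rw [map_smul, hb', e'])

theorem mem_W_of_coeffMap_mem_W [Module.IsTorsionFree R A] [Module.IsTorsionFree R B]
    {f : A →ₐ[R] B} (hf : Function.Injective f)
    (hsat : ∀ (c : R) (b : B) (a : A), c ≠ 0 → c • b = f a → b ∈ f.range)
    {ξ : Idl R → A} (h : coeffMap f ξ ∈ W R B) : ξ ∈ W R A :=
  mem_W.mpr fun n => mem_U_of_coeffMap_mem_U hf hsat n (mem_W.mp h n)

end CoeffMap

section Monoid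

theorem finite_powers_of_pow_eq {Q : Type*} [CommMonoid Q] (x : Q) {n f : ℕ} (hf : 0 < f)
    (h : x ^ (n + f) = x ^ n) : (Submonoid.powers x : Set Q).Finite := by
  refine ((Set.finite_Iio (n + f)).image (x ^ ·)).subset ?_
  rintro _ ⟨k, rfl⟩
  induction k using Nat.strong_induction_on with
  | _ k ih =>
    by_cases hk : k < n + f
    · exact ⟨k, hk, rfl⟩
    · obtain ⟨m, rfl⟩ := Nat.exists_eq_add_of_le (not_lt.mp hk)
      have : x ^ (n + f + m) = x ^ (n + m) := by rw [pow_add, h, ← pow_add]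
      simpa only [this] using ih (n + m) (by omega)

theorem finite_closure_of_pow_eq {Q : Type*} [CommMonoid Q] {s : Set Q} (hs : s.Finite)
    (h : ∀ x ∈ s, ∃ n f : ℕ, 0 < f ∧ x ^ (n + f) = x ^ n) :
    (Submonoid.closure s : Set Q).Finite := by
  induction s, hs using Set.Finite.induction_on with
  | empty => simp
  | @insert x s _ _ ih =>
    obtain ⟨n, f, hf, hx⟩ := h x (Set.mem_insert _ _)
    rw [Set.insert_eq, Submonoid.closure_union, Submonoid.coe_sup]
    refine Set.Finite.mul ?_ (ih fun y hy => h y (Set.mem_insert_of_mem _ hy))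
    rw [← Submonoid.powers_eq_closure]
    exact finite_powers_of_pow_eq x hf hx

end Monoid

section Automata

variable {R : Type*} [CommRing R] [IsDedekindDomain R]
variable {A : Type*}

theorem exists_list_prod_primeIdl (a : Idl R) :
    ∃ u : List (HeightOneSpectrum R), (u.map primeIdl).prod = a := by
  obtain ⟨I, hI⟩ := a
  induction I using UniqueFactorizationMonoid.induction_on_prime with
  | h₁ => exact absurd rfl (nonZeroDivisors.ne_zero hI)
  | h₂ I hu =>
    refine ⟨[], Subtype.ext ?_⟩
    simpa [eq_comm, Ideal.isUnit_iff, Ideal.one_eq_top] using hu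
  | h₃ I p hI0 hp ih =>
    obtain ⟨u, hu⟩ := ih (mem_nonZeroDivisors_of_ne_zero hI0)
    refine ⟨⟨p, Ideal.isPrime_of_prime hp, hp.ne_zero⟩ :: u, Subtype.ext ?_⟩
    rw [List.map_cons, List.prod_cons, hu]
    rfl

theorem closure_range_primeIdl :
    Submonoid.closure (Set.range (primeIdl : HeightOneSpectrum R → Idl R)) = ⊤ := by
  refine eq_top_iff.mpr fun a _ => ?_
  obtain ⟨u, rfl⟩ := exists_list_prod_primeIdl a
  refine Submonoid.list_prod_mem _ fun x hx => ?_
  obtain ⟨p, -, rfl⟩ := List.mem_map.mp hx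
  exact Submonoid.subset_closure ⟨p, rfl⟩

/-- The congruence of ideals which are not distinguished by the shifts of `ξ`. -/
def shiftCon (ξ : Idl R → A) : Con (Idl R) where
  r a a' := ∀ b, ξ (a * b) = ξ (a' * b)
  iseqv := ⟨fun _ _ => rfl, fun h b => (h b).symm, fun h h' b => (h b).trans (h' b)⟩
  mul' {a a' c c'} h h' b := by
    rw [mul_assoc, h, mul_left_comm, h', mul_left_comm, mul_assoc]

theorem isAutomatic_of_finite_quotient (ξ : Idl R → A) (h : Finite (shiftCon ξ).Quotient) :
    IsAutomatic ξ := by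
  obtain ⟨n, ⟨e⟩⟩ := Finite.exists_equiv_fin (shiftCon ξ).Quotient
  let out : (shiftCon ξ).Quotient → A := fun x => Con.liftOn x ξ fun a a' h => by
    simpa using h 1
  let M : DFAO (HeightOneSpectrum R) A (Fin n) :=
    ⟨fun s p => e (e.symm s * (primeIdl p : Idl R)), e 1, fun s => out (e.symm s)⟩
  have key : ∀ (u : List (HeightOneSpectrum R)) (a : Idl R),
      u.foldl M.step (e (a : (shiftCon ξ).Quotient)) =
        e ((a * (u.map primeIdl).prod : Idl R) : (shiftCon ξ).Quotient) := by
    intro u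
    induction u with
    | nil => intro a; simp
    | cons p u ih =>
      intro a
      rw [List.foldl_cons, List.map_cons, List.prod_cons, ← mul_assoc, ← ih]
      congr 1
      simp [M]
  refine ⟨Fin n, inferInstance, M, fun u => ?_⟩
  have := key u 1
  rw [one_mul] at this
  change _ = out (e.symm (u.foldl M.step (e ((1 : Idl R) : (shiftCon ξ).Quotient))))
  rw [this, e.symm_apply_apply]
  rfl

theorem IsAutomatic.finite_range {ξ : Idl R → A} (h : IsAutomatic ξ) :
    (Set.range ξ).Finite := by
  obtain ⟨S, hS, M, hM⟩ := h
  refine (Set.finite_range M.out).subset ?_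
  rintro _ ⟨a, rfl⟩
  obtain ⟨u, rfl⟩ := exists_list_prod_primeIdl a
  exact ⟨M.run u, (hM u).symm⟩

/-- A family is automatic if the shifts of almost all primes act on its values through maps of a
finite set, and the powers of each shift are eventually periodic on it. -/
theorem isAutomatic_of_periodic {ξ : Idl R → A} (hfin : (Set.range ξ).Finite)
    (hper : ∀ p : HeightOneSpectrum R, ∃ n f : ℕ, 0 < f ∧
      ∀ a, ξ (primeIdl p ^ (n + f) * a) = ξ (primeIdl p ^ n * a))
    (hgood : {p : HeightOneSpectrum R | ¬ ∀ a b, ξ a = ξ b →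
      ξ (primeIdl p * a) = ξ (primeIdl p * b)}.Finite) : IsAutomatic ξ := by
  apply isAutomatic_of_finite_quotient
  let π : Idl R → (shiftCon ξ).Quotient := (↑)
  have hclos : Submonoid.closure (Set.range (π ∘ primeIdl)) = ⊤ := by
    have := congrArg (Submonoid.map (shiftCon ξ).mk') (closure_range_primeIdl (R := R))
    rw [MonoidHom.map_mclosure, ← Set.range_comp, ← MonoidHom.mrange_eq_map,
      Con.mrange_mk'] at this
    exact this
  have hrange : (Set.range (π ∘ primeIdl)).Finite := by
    have : Finite (Set.range ξ) := hfin
    set G : Set (HeightOneSpectrum R) := {p | ¬ ∀ a b, ξ a = ξ b →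
      ξ (primeIdl p * a) = ξ (primeIdl p * b)} with hG
    have h2 : ((π ∘ primeIdl) '' Gᶜ).Finite := by
      have hg : ∀ p : HeightOneSpectrum R, p ∈ Gᶜ → ∃ g : Set.range ξ → Set.range ξ,
          ∀ a, ξ (primeIdl p * a) = g ⟨ξ a, a, rfl⟩ := by
        intro p hp
        have hp' : ∀ a b, ξ a = ξ b → ξ (primeIdl p * a) = ξ (primeIdl p * b) := by
          simpa [hG] using hp
        refine ⟨fun v => ⟨ξ (primeIdl p * v.2.choose), _, rfl⟩, fun a => ?_⟩
        exact hp' _ _ (Exists.choose_spec (⟨a, rfl⟩ : ξ a ∈ Set.range ξ)).symm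
      choose! g hg using hg
      rcases Gᶜ.eq_empty_or_nonempty with he | ⟨p₀, -⟩
      · simp [he]
      have : Nonempty (HeightOneSpectrum R) := ⟨p₀⟩
      refine (Set.finite_range fun φ => π (primeIdl (Function.invFunOn g Gᶜ φ))).subset ?_
      rintro _ ⟨p, hp, rfl⟩
      have hex : ∃ q ∈ Gᶜ, g q = g p := ⟨p, hp, rfl⟩
      refine ⟨g p, (Con.eq _).mpr fun b => ?_⟩
      rw [hg _ (Function.invFunOn_mem hex), hg _ hp, Function.invFunOn_eq hex]
    rw [← Set.image_univ, ← Set.union_compl_self G, Set.image_union]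
    exact (hgood.image _).union h2
  have hfinal := finite_closure_of_pow_eq hrange (by
    rintro _ ⟨p, rfl⟩
    obtain ⟨n, f, hf, h⟩ := hper p
    exact ⟨n, f, hf, (Con.eq _).mpr h⟩)
  rw [hclos] at hfinal
  exact Set.finite_univ_iff.mp hfinal

end Automata

section Periodicity

theorem pow_sub_pow_mem_pow_succ {A : Type*} [CommRing A] {I : Ideal A} {q : ℕ}
    (hq : (q : A) ∈ I) {x y : A} {N : ℕ} (h : x - y ∈ I ^ (N + 1)) :
    x ^ q - y ^ q ∈ I ^ (N + 2) := by
  rw [← Commute.geom_sum₂_mul (Commute.all x y), pow_succ', pow_succ' I]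
  refine Ideal.mul_mem_mul ?_ (by rwa [← pow_succ'])
  have hxy : Ideal.Quotient.mk I x = Ideal.Quotient.mk I y :=
    Ideal.Quotient.eq.mpr (Ideal.pow_le_self N.succ_ne_zero h)
  rw [← Ideal.Quotient.eq_zero_iff_mem, map_sum]
  simp only [map_mul, map_pow, hxy]
  rw [geom_sum₂_self, ← map_natCast (Ideal.Quotient.mk I), Ideal.Quotient.eq_zero_iff_mem.mpr hq,
    zero_mul]

theorem exists_iterate_add_eq {X : Type*} [Finite X] (φ : X → X) :
    ∃ n f : ℕ, 0 < f ∧ φ^[n + f] = φ^[n] := by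
  obtain ⟨m, n, hne, h⟩ := Finite.exists_ne_map_eq_of_infinite fun k => φ^[k]
  rcases hne.lt_or_gt with hlt | hlt
  · exact ⟨m, n - m, by omega, by rw [Nat.add_sub_cancel' hlt.le]; exact h.symm⟩
  · exact ⟨n, m - n, by omega, by rw [Nat.add_sub_cancel' hlt.le]; exact h⟩

theorem resCard_mem {R : Type*} [CommRing R] [Ring.HasFiniteQuotients R]
    (p : HeightOneSpectrum R) : (resCard p : R) ∈ p.asIdeal := by
  have : Finite (R ⧸ p.asIdeal) := Ring.HasFiniteQuotients.finiteQuotient p.ne_bot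
  rw [← Ideal.Quotient.eq_zero_iff_mem, map_natCast, resCard]
  let _ := Fintype.ofFinite (R ⧸ p.asIdeal)
  rw [Nat.card_eq_fintype_card, Nat.cast_card_eq_zero]

theorem primeMul_apply_mem {R A : Type*} [CommRing R] [CommRing A] [Algebra R A]
    (p : HeightOneSpectrum R) (B : Subalgebra R (Idl R → A))
    {x : Idl R → A} (hx : x ∈ primeMul p B) (a : Idl R) :
    x a ∈ p.asIdeal.map (algebraMap R A) := by
  induction hx using Submodule.smul_induction_on' with
  | smul r hr n _ =>
    rw [Pi.smul_apply, Algebra.smul_def]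
    exact Ideal.mul_mem_right _ _ (Ideal.mem_map_of_mem _ hr)
  | add x _ y _ hx hy => exact Ideal.add_mem _ hx hy

section FinitelyManyPrimes

variable {R : Type*} [CommRing R] [IsDedekindDomain R]

theorem finite_setOf_mem_asIdeal {c : R} (hc : c ≠ 0) :
    {p : HeightOneSpectrum R | c ∈ p.asIdeal}.Finite := by
  have := Ideal.finite_factors (I := Ideal.span {c}) (by simpa using hc)
  simpa only [Ideal.dvd_span_singleton] using this

variable {A : Type*} [CommRing A] [Algebra R A]
variable [Module.IsTorsionFree R A] [IsDomain A] [Algebra.IsIntegral R A]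

theorem map_asIdeal_ne_top (p : HeightOneSpectrum R) :
    p.asIdeal.map (algebraMap R A) ≠ ⊤ := by
  obtain ⟨P, hP, hPp⟩ := Ideal.exists_ideal_over_prime_of_isIntegral_of_isDomain (S := A) p.asIdeal
    (by simp [FaithfulSMul.ker_algebraMap_eq_bot R A])
  exact fun h => hP.ne_top (eq_top_iff.mpr (h ▸ Ideal.map_le_iff_le_comap.mpr hPp.ge))

theorem finite_setOf_mem_map {x : A} (hx : x ≠ 0) :
    {p : HeightOneSpectrum R | x ∈ p.asIdeal.map (algebraMap R A)}.Finite := by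
  have hne : (Ideal.span {x}).comap (algebraMap R A) ≠ ⊥ :=
    Ideal.comap_ne_bot_of_integral_mem hx (Ideal.mem_span_singleton_self x)
      (Algebra.IsIntegral.isIntegral x)
  obtain ⟨c, hc, hc0⟩ := Submodule.exists_mem_ne_zero_of_ne_bot hne
  refine (finite_setOf_mem_asIdeal hc0).subset fun p hp => ?_
  obtain ⟨P, hP, hPp⟩ := Ideal.exists_ideal_over_prime_of_isIntegral_of_isDomain (S := A) p.asIdeal
    (by simp [FaithfulSMul.ker_algebraMap_eq_bot R A])
  change c ∈ p.asIdeal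
  rw [← hPp, Ideal.mem_comap]
  exact (Ideal.span_singleton_le_iff_mem P).mpr (Ideal.map_le_iff_le_comap.mpr hPp.ge hp)
    (Ideal.mem_comap.mp hc)

end FinitelyManyPrimes

variable {R : Type*} [CommRing R] [IsDedekindDomain R] [Ring.HasFiniteQuotients R]
variable {A : Type*} [CommRing A] [Algebra R A] [Module.IsTorsionFree R A]

theorem mk_apply_pow_mul {ξ : Idl R → A} (h : ξ ∈ W R A) (p : HeightOneSpectrum R) (k : ℕ)
    (a : Idl R) :
    Ideal.Quotient.mk (p.asIdeal.map (algebraMap R A)) (ξ (primeIdl p ^ k * a)) =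
      (fun x => x ^ resCard p)^[k] (Ideal.Quotient.mk _ (ξ a)) := by
  induction k with
  | zero => simp
  | succ k ih =>
    rw [Function.iterate_succ_apply', ← ih, ← map_pow, Ideal.Quotient.eq, pow_succ', mul_assoc]
    exact primeMul_apply_mem p _ (shift_sub_pow_mem_primeMul_W h p) (primeIdl p ^ k * a)

/-- The powers of the shift at `p` are eventually periodic modulo each power of `p`, with
a period which does not depend on that power. -/
theorem exists_periodic_mod_pow (p : HeightOneSpectrum R)
    [Finite (A ⧸ p.asIdeal.map (algebraMap R A))] :
    ∃ n f : ℕ, 0 < f ∧ ∀ N, ∀ ξ ∈ W R A, ∀ a,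
      ξ (primeIdl p ^ (n + N + f) * a) - ξ (primeIdl p ^ (n + N) * a) ∈
        p.asIdeal.map (algebraMap R A) ^ (N + 1) := by
  set I := p.asIdeal.map (algebraMap R A) with hI
  obtain ⟨n, f, hf, hper⟩ := exists_iterate_add_eq fun x : A ⧸ I => x ^ resCard p
  refine ⟨n, f, hf, fun N => ?_⟩
  induction N with
  | zero =>
    intro ξ h a
    rw [zero_add, pow_one, add_zero, ← Ideal.Quotient.eq, mk_apply_pow_mul h, mk_apply_pow_mul h,
      hper]
  | succ N ih =>
    intro ξ h a
    have key : ∀ z ∈ primeMul p (W R A), ∀ a,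
        z (primeIdl p ^ (n + N + f) * a) - z (primeIdl p ^ (n + N) * a) ∈ I ^ (N + 2) := by
      intro z hz a
      induction hz using Submodule.smul_induction_on' with
      | smul r hr η hη =>
        rw [Pi.smul_apply, Pi.smul_apply, ← smul_sub, Algebra.smul_def, pow_succ']
        exact Ideal.mul_mem_mul (Ideal.mem_map_of_mem _ hr) (ih η hη a)
      | add x _ y _ hx hy =>
        rw [Pi.add_apply, Pi.add_apply, add_sub_add_comm]
        exact Ideal.add_mem _ hx hy
    have hq : (resCard p : A) ∈ I := by
      rw [← map_natCast (algebraMap R A)]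
      exact Ideal.mem_map_of_mem _ (resCard_mem p)
    have h1 := key _ (shift_sub_pow_mem_primeMul_W h p) a
    have h2 := pow_sub_pow_mem_pow_succ hq (ih ξ h a)
    have e : ∀ k, shift A p ξ (primeIdl p ^ k * a) = ξ (primeIdl p ^ (k + 1) * a) := fun k => by
      rw [pow_succ', mul_assoc]; rfl
    rw [Pi.sub_apply, Pi.sub_apply, Pi.pow_apply, Pi.pow_apply, e, e] at h1
    have h3 := Ideal.add_mem _ h1 h2
    rw [show n + (N + 1) + f = n + N + f + 1 by ring, show n + (N + 1) = n + N + 1 by ring]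
    convert h3 using 1
    ring

theorem isAutomatic_of_finite_range [IsDomain A] [Algebra.IsIntegral R A] [IsNoetherianRing A]
    [Ring.HasFiniteQuotients A] {ξ : Idl R → A} (h : ξ ∈ W R A) (hfin : (Set.range ξ).Finite) :
    IsAutomatic ξ := by
  have hD : ((Set.range ξ ×ˢ Set.range ξ) ∩ {v | v.1 ≠ v.2}).Finite :=
    (hfin.prod hfin).inter_of_left _
  refine isAutomatic_of_periodic hfin (fun p => ?_) ?_
  · have hbot : p.asIdeal.map (algebraMap R A) ≠ ⊥ := by
      rw [Ne, Ideal.map_eq_bot_iff_of_injective (FaithfulSMul.algebraMap_injective R A)]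
      exact p.ne_bot
    have : Finite (A ⧸ p.asIdeal.map (algebraMap R A)) :=
      Ring.HasFiniteQuotients.finiteQuotient hbot
    obtain ⟨n, f, hf, hper⟩ := exists_periodic_mod_pow (A := A) p
    have hsep : ∀ v : A × A, v.1 ≠ v.2 → ∃ N, v.1 - v.2 ∉
        p.asIdeal.map (algebraMap R A) ^ N := by
      intro v hv
      by_contra! hall
      have : v.1 - v.2 ∈ ⨅ N : ℕ, p.asIdeal.map (algebraMap R A) ^ N := Ideal.mem_iInf.mpr hall
      rw [Ideal.iInf_pow_eq_bot_of_isDomain _ (map_asIdeal_ne_top p)] at this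
      exact hv (sub_eq_zero.mp this)
    choose! N hN using hsep
    obtain ⟨M, hM⟩ := (hD.image N).bddAbove
    refine ⟨n + M, f, hf, fun a => ?_⟩
    by_contra hne
    refine hN (ξ (primeIdl p ^ (n + M + f) * a), ξ (primeIdl p ^ (n + M) * a)) hne
      (Ideal.pow_le_pow_right ?_ (hper M ξ h a))
    exact (hM ⟨_, ⟨⟨⟨_, rfl⟩, ⟨_, rfl⟩⟩, hne⟩, rfl⟩).trans M.le_succ
  · refine (hD.biUnion fun v hv => finite_setOf_mem_map (R := R) (sub_ne_zero.mpr hv.2)).subset ?_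
    intro p hp
    obtain ⟨a, b, hab, hne⟩ : ∃ a b, ξ a = ξ b ∧ ξ (primeIdl p * a) ≠ ξ (primeIdl p * b) := by
      simpa using hp
    refine Set.mem_biUnion (x := (ξ (primeIdl p * a), ξ (primeIdl p * b)))
      ⟨⟨⟨_, rfl⟩, ⟨_, rfl⟩⟩, hne⟩ ?_
    have e := mk_apply_pow_mul h p 1 a
    rw [hab, ← mk_apply_pow_mul h p 1 b, pow_one] at e
    exact Ideal.Quotient.eq.mp e

end Periodicity

section Integrality

variable {R A : Type*} [CommRing R] [CommRing A] [Algebra R A]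

theorem aeval_pi_apply {ι : Type*} (ξ : ι → A) (P : Polynomial R) (i : ι) :
    Polynomial.aeval ξ P i = Polynomial.aeval (ξ i) P :=
  (Polynomial.aeval_algHom_apply (Pi.evalAlgHom R (fun _ : ι => A) i) ξ P).symm

theorem isIntegral_of_finite_range [Algebra.IsIntegral R A] {ι : Type*} {ξ : ι → A}
    (h : (Set.range ξ).Finite) : IsIntegral R ξ := by
  choose P hP hP' using fun x : A => Algebra.IsIntegral.isIntegral (R := R) x
  refine ⟨∏ x ∈ h.toFinset, P x, Polynomial.monic_prod_of_monic _ _ fun x _ => hP x, ?_⟩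
  rw [← Polynomial.aeval_def]
  funext i
  rw [Pi.zero_apply, aeval_pi_apply, map_prod]
  refine Finset.prod_eq_zero (i := ξ i) (by simp) ?_
  exact hP' (ξ i)

theorem finite_range_of_isIntegral [IsDomain A] {ι : Type*} {ξ : ι → A}
    (h : IsIntegral R ξ) : (Set.range ξ).Finite := by
  obtain ⟨P, hP, hP'⟩ := h
  refine (Polynomial.rootSet_finite P A).subset ?_
  rintro _ ⟨i, rfl⟩
  have := congrFun hP' i
  rw [← Polynomial.aeval_def, aeval_pi_apply] at this
  exact (Polynomial.mem_rootSet' (p := P)).mpr ⟨(hP.map _).ne_zero, this⟩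

end Integrality

section NumberField

variable {K : Type*} [Field K] {Kbar : Type*} [Field Kbar] [Algebra K Kbar]

theorem ringOfIntegers_mem_range_of_mem (L : IntermediateField K Kbar) (b : 𝓞 Kbar)
    (h : (b : Kbar) ∈ L) : b ∈ (IsScalarTower.toAlgHom (𝓞 K) (𝓞 L) (𝓞 Kbar)).range := by
  have hint : IsIntegral ℤ (⟨b, h⟩ : L) := by
    rw [← isIntegral_algebraMap_iff (B := Kbar) (FaithfulSMul.algebraMap_injective L Kbar)]
    exact b.isIntegral_coe
  exact ⟨⟨_, hint⟩, by ext; rfl⟩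

theorem ringOfIntegers_toAlgHom_injective (L : IntermediateField K Kbar) :
    Function.Injective (IsScalarTower.toAlgHom (𝓞 K) (𝓞 L) (𝓞 Kbar)) :=
  FaithfulSMul.algebraMap_injective (𝓞 L) (𝓞 Kbar)

theorem ringOfIntegers_mem_range_of_smul_eq (L : IntermediateField K Kbar) (c : 𝓞 K)
    (b : 𝓞 Kbar) (a : 𝓞 L) (hc : c ≠ 0)
    (h : c • b = IsScalarTower.toAlgHom (𝓞 K) (𝓞 L) (𝓞 Kbar) a) :
    b ∈ (IsScalarTower.toAlgHom (𝓞 K) (𝓞 L) (𝓞 Kbar)).range := by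
  apply ringOfIntegers_mem_range_of_mem
  have e : algebraMap K Kbar (c : K) * (b : Kbar) = ((a : L) : Kbar) := by
    have := congrArg (algebraMap (𝓞 Kbar) Kbar) h
    rw [Algebra.smul_def, map_mul] at this
    exact this
  have hc' : algebraMap K Kbar (c : K) ≠ 0 := by simpa using hc
  rw [← eq_inv_mul_iff_mul_eq₀ hc', ← map_inv₀] at e
  rw [e]
  exact L.mul_mem (L.algebraMap_mem _) (a : L).2

variable [NumberField K]

/-- A Witt vector with finitely many coefficients is an automatic Witt vector over a finite
extension. -/
theorem exists_mem_Wa_of_finite_range {ξ : Idl (𝓞 K) → 𝓞 Kbar} (h : ξ ∈ W (𝓞 K) (𝓞 Kbar))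
    (hfin : (Set.range ξ).Finite) :
    ∃ L : IntermediateField K Kbar, FiniteDimensional K L ∧ ∃ η ∈ Wa (𝓞 K) (𝓞 L),
      coeffMap (IsScalarTower.toAlgHom (𝓞 K) (𝓞 L) (𝓞 Kbar)) η = ξ := by
  let V : Set Kbar := Set.range fun a => (ξ a : Kbar)
  have hV : V.Finite := by
    have := hfin.image (algebraMap (𝓞 Kbar) Kbar)
    rwa [← Set.range_comp] at this
  have : Finite V := hV
  let L := IntermediateField.adjoin K V
  have hL : FiniteDimensional K L := IntermediateField.finiteDimensional_adjoin (by
    rintro _ ⟨a, rfl⟩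
    exact (ξ a).isIntegral_coe.tower_top)
  have : NumberField L := NumberField.of_module_finite K L
  have : Algebra.IsIntegral (𝓞 K) (𝓞 L) := Algebra.IsIntegral.tower_top (R := ℤ)
  choose η hη using fun a => ringOfIntegers_mem_range_of_mem L (ξ a)
    (IntermediateField.subset_adjoin K V ⟨a, rfl⟩)
  have hcoeff : coeffMap (IsScalarTower.toAlgHom (𝓞 K) (𝓞 L) (𝓞 Kbar)) η = ξ := funext hη
  have hinj := ringOfIntegers_toAlgHom_injective L
  have hW : η ∈ W (𝓞 K) (𝓞 L) := mem_W_of_coeffMap_mem_W hinj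
    (ringOfIntegers_mem_range_of_smul_eq L) (hcoeff ▸ h)
  have hfin' : (Set.range η).Finite := by
    refine Set.Finite.of_finite_image ?_ (hinj.injOn (s := Set.range η))
    rw [← Set.range_comp]
    exact (funext hη : _ ∘ η = ξ) ▸ hfin
  exact ⟨L, hL, η, ⟨hW, isAutomatic_of_finite_range hW hfin'⟩, hcoeff⟩

theorem coeffMap_mem_Wa (L : IntermediateField K Kbar) {η : Idl (𝓞 K) → 𝓞 L}
    (h : η ∈ Wa (𝓞 K) (𝓞 L)) :
    coeffMap (IsScalarTower.toAlgHom (𝓞 K) (𝓞 L) (𝓞 Kbar)) η ∈ Wa (𝓞 K) (𝓞 Kbar) :=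
  ⟨coeffMap_mem_W _ h.1, h.2.comp (algebraMap (𝓞 L) (𝓞 Kbar)) fun _ => rfl⟩

end NumberField

end ArithWitt

theorem mainTheorem2 (K : Type*) [Field K] [NumberField K]
    (Kbar : Type*) [Field Kbar] [Algebra K Kbar] [IsSepClosure K Kbar] :
    (∀ ξ : ArithWitt.W (𝓞 K) (𝓞 Kbar),
      IsIntegral (𝓞 K) ξ ↔ ArithWitt.IsAutomatic (ξ : ArithWitt.Idl (𝓞 K) → 𝓞 Kbar)) ∧
    ArithWitt.IsLambdaSubring (ArithWitt.Wa (𝓞 K) (𝓞 Kbar)) ∧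
    (∀ L : IntermediateField K Kbar, FiniteDimensional K L →
      ArithWitt.IsLambdaSubring (ArithWitt.Wa (𝓞 K) (𝓞 L))) ∧
    (ArithWitt.Wa (𝓞 K) (𝓞 Kbar) : Set (ArithWitt.Idl (𝓞 K) → 𝓞 Kbar)) =
      ⋃ (L : IntermediateField K Kbar) (_ : FiniteDimensional K L),
        ((ArithWitt.Wa (𝓞 K) (𝓞 L)).map
          (ArithWitt.coeffMap (IsScalarTower.toAlgHom (𝓞 K) (𝓞 L) (𝓞 Kbar))) :
            Set (ArithWitt.Idl (𝓞 K) → 𝓞 Kbar)) := by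
  refine ⟨fun ξ => ?_, ArithWitt.isLambdaSubring_Wa, fun L _ => ArithWitt.isLambdaSubring_Wa, ?_⟩
  · rw [← isIntegral_algHom_iff (ArithWitt.W (𝓞 K) (𝓞 Kbar)).val Subtype.val_injective]
    constructor
    · intro h
      obtain ⟨L, -, η, hη, e⟩ := ArithWitt.exists_mem_Wa_of_finite_range ξ.2
        (ArithWitt.finite_range_of_isIntegral h)
      exact e ▸ (ArithWitt.coeffMap_mem_Wa L hη).2
    · have : Algebra.IsIntegral (𝓞 K) (𝓞 Kbar) := Algebra.IsIntegral.tower_top (R := ℤ)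
      exact fun h => ArithWitt.isIntegral_of_finite_range h.finite_range
  · ext ξ
    simp only [Set.mem_iUnion, SetLike.mem_coe, Subalgebra.mem_map]
    constructor
    · intro h
      obtain ⟨L, hL, η, hη, e⟩ := ArithWitt.exists_mem_Wa_of_finite_range h.1 h.2.finite_range
      exact ⟨L, hL, η, hη, e⟩
    · rintro ⟨L, -, η, hη, rfl⟩
      exact ArithWitt.coeffMap_mem_Wa L hη
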